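/- Let $n\ge 1$, $r\ge 0$ and let $\mathcal X$ be a finite set of augmented samples divided into $r+1$ classes with exactly $n$ samples each. Let $\mathcal P$ be a probability distribution on a space $\bar{\mathcal X}$ of natural data, let $y:\bar{\mathcal X}\to\{0,\dots,r\}$ be the (measurable) labels, and for $\bar x\in\bar{\mathcal X}$ let $\mathcal A(\cdot\mid\bar x)$ be the distribution on $\mathcal X$ of its augmentations. Put $w_{xx'}=\mathbb E_{\bar x\sim\mathcal P}[\mathcal A(x\mid\bar x)\mathcal A(x'\mid\bar x)]$ and $w_x=\sum_{x'}w_{xx'}$. Let $0\le\beta<\alpha<1$ and suppose that there are no difficult-to-learn examples, i.e. that $(w_{xx'})$ is the matrix with entries $1$ if $x=x'$, $\alpha$ if $x\ne x'$ lie in the same class, and $\beta$ if $x,x'$ lie in different classes, divided by the sum of its entries. Suppose further that labels are recoverable with error $\delta$: there is $g:\mathcal X\to\{0,\dots,r\}$ with $\Pr_{\bar x\sim\mathcal P,\,x\sim\mathcal A(\cdot\mid\bar x)}[g(x)=y(\bar x)]\ge 1-\delta$. Let $k>r$ and let $\mathcal F$ be a set of functions $\mathcal X\to\mathbb R^k$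 that contains at least one global minimizer, over all functions $\mathcal X\to\mathbb R^k$, of the population spectral contrastive loss $$\mathcal L(f)=-2\sum_{x,x'}w_{xx'}\,f(x)^\top f(x')+\sum_{x,x'}w_xw_{x'}\bigl(f(x)^\top f(x')\bigr)^2 .$$ Let $f$ be any minimizer of $\mathcal L$ over $\mathcal F$, and let $$\mathcal E_{\mathrm{w.o.}}=\inf_{B\in\mathbb R^{(r+1)\times k}}\Pr_{\bar x\sim\mathcal P,\,x\sim\mathcal A(\cdot\mid\bar x)}\Bigl[\operatorname*{arg\,max}_{0\le i\le r}(Bf(x))_i\ne y(\bar x)\Bigr]$$ be its linear probing error, where the $\arg\max$ breaks ties by an arbitrary fixed rule. Then $$\mathcal E_{\mathrm{w.o.}}\le\frac{4\delta}{1-\frac{1-\alpha}{(1-\alpha)+n\alpha+nr\beta}}+8\delta .$$ -/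

import Mathlib

open MeasureTheory ProbabilityTheory

noncomputable section

namespace ContrastiveLearning

variable {N X : Type*} [MeasurableSpace N] [MeasurableSpace X] [Fintype X]

/-- The augmentation-graph weight `w_{x x'}`: the probability that `x` and `x'` are two views drawn
independently from `A(· | x̄)` for one and the same natural datum `x̄ ∼ P`. Here `N` is the space of
natural data and `X` the finite set of augmented data. -/
def augWeight (P : Measure N) (A : Kernel N X) (x x' : X) : ℝ :=
  ∫ z, (A z).real {x} * (A z).real {x'} ∂P

/-- The marginal weight `w_x = ∑_{x'} w_{x x'}`. -/
def augMarginal (P : Measure N) (A : Kernel N X) (x : X) : ℝ :=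
  ∑ x' : X, augWeight P A x x'

/-- The population spectral contrastive loss
`-2 E_{x,x⁺}[f(x)ᵀ f(x⁺)] + E_{x,x'}[(f(x)ᵀ f(x'))²]`: positive pairs `(x, x⁺)` have joint law
`w_{x x⁺}`, and `x, x'` are independent with law `w_x`. -/
def spectralLoss (P : Measure N) (A : Kernel N X) {k : ℕ} (f : X → Fin k → ℝ) : ℝ :=
  -2 * ∑ x : X, ∑ x' : X, augWeight P A x x' * (f x ⬝ᵥ f x')
    + ∑ x : X, ∑ x' : X, augMarginal P A x * augMarginal P A x' * (f x ⬝ᵥ f x') ^ 2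

/-- The idealized similarity without difficult-to-learn examples: `1` between a sample and itself,
`a` between distinct samples of one class, `b` between samples of different classes. -/
def similarity [DecidableEq X] {m : ℕ} (cls : X → Fin m) (a b : ℝ) (x x' : X) : ℝ :=
  if x = x' then 1 else if cls x = cls x' then a else b

/-- The augmentation graph is the idealized similarity graph: its weights are the similarities,
normalized to total mass `1` (as a joint probability must be). -/
def IsSimilarityGraph [DecidableEq X] {m : ℕ} (P : Measure N) (A : Kernel N X)
    (cls : X → Fin m) (a b : ℝ) : Prop :=
  ∀ x x' : X, augWeight P A x x' =
    similarity cls a b x x' / ∑ u : X, ∑ v : X, similarity cls a b u v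

/-- Labels are recoverable from augmentations with error `δ`: some classifier `g` of augmented data
satisfies `g(x) = y(x̄)` with probability at least `1 - δ`, for `x̄ ∼ P` and `x ∼ A(· | x̄)`. -/
def LabelsRecoverable {m : ℕ} (P : Measure N) (A : Kernel N X) (y : N → Fin m) (δ : ℝ) : Prop :=
  ∃ g : X → Fin m, 1 - δ ≤ (P.compProd A).real {p | g p.2 = y p.1}

/-- Realizability: the hypothesis class contains a global minimizer of the population spectral
contrastive loss over all functions `X → ℝᵏ`. -/
def Realizable (P : Measure N) (A : Kernel N X) {k : ℕ} (H : Set (X → Fin k → ℝ)) : Prop :=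
  ∃ f ∈ H, ∀ f' : X → Fin k → ℝ, spectralLoss P A f ≤ spectralLoss P A f'

/-- `f` is a minimizer over the hypothesis class `H` of the population spectral contrastive loss. -/
def IsSpectralMinimizer (P : Measure N) (A : Kernel N X) {k : ℕ} (H : Set (X → Fin k → ℝ))
    (f : X → Fin k → ℝ) : Prop :=
  f ∈ H ∧ ∀ f' ∈ H, spectralLoss P A f ≤ spectralLoss P A f'

/-- `s` selects an index of a largest coordinate of every vector (an `argmax` with some rule for
breaking ties). -/
def IsArgmaxRule {m : ℕ} (s : (Fin m → ℝ) → Fin m) : Prop :=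
  ∀ (v : Fin m → ℝ) (j : Fin m), v j ≤ v (s v)

/-- The linear probing error of the representation `f`: the least probability, over all linear heads
`B`, that the classifier `x ↦ argmax_i (B f(x))_i` (with tie-breaking rule `s`) does not predict the
label `y(x̄)`, for `x̄ ∼ P` and `x ∼ A(· | x̄)`. -/
def linearProbingError {m k : ℕ} (P : Measure N) (A : Kernel N X) (y : N → Fin m)
    (s : (Fin m → ℝ) → Fin m) (f : X → Fin k → ℝ) : ℝ :=
  ⨅ B : Matrix (Fin m) (Fin k) ℝ,
    (P.compProd A).real {p | s (B.mulVec (f p.2)) ≠ y p.1}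

end ContrastiveLearning

end

/-! Write `m = r + 1`, `T = m * n` and `D = (1 - α) + n α + n r β`, the common row sum of the
similarity matrix. All marginals equal `1 / T`, so `T ^ 2` times the spectral loss is the loss of
approximating `M = T ^ 2 w` by a Gram matrix `F Fᵀ` of rank at most `k`. Here `M = ν I + K`, where
`ν > 0` and `K` is block constant, positive semidefinite, of rank at most `m ≤ k`, with range the
class-constant functions. As in Eckart–Young, the columns of a minimizer span a space containing the
range of `K` (`exists_mulVec_eq_of_minimizer`). This is proved by rank-one perturbations of `F`,
without diagonalizing `M`. Hence a linear head on `f` can realize any labelling `σ ∘ cls`.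

It remains to find a good `σ`. Let `g` have label error `ε ≤ δ`. Two views of one datum get
different `g`-labels with probability at most `2 ε`. Taking `σ` to be the majority vote of `g` in
each class, a pair count (`exists_sum_ne_le_sum_similarity`) bounds the disagreement of `σ ∘ cls`
with `g` by `2 ε` over the spectral gap `1 - (1 - α) / D`. The union bound adds `ε`. -/

namespace ContrastiveLearning

open Matrix

/-! ### Minimizers of the low-rank approximation loss -/

section LowRankApproximation

variable {X : Type*} [Fintype X] {k : ℕ}

/-- The low-rank approximation loss `‖M - F Fᵀ‖² - ‖M‖²` of a symmetric matrix `M`. -/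
def factorLoss (M : Matrix X X ℝ) (F : Matrix X (Fin k) ℝ) : ℝ :=
  -2 * ∑ x, ∑ x', M x x' * (F x ⬝ᵥ F x') + ∑ x, ∑ x', (F x ⬝ᵥ F x') ^ 2

theorem sum_sum_mul_mul (M : Matrix X X ℝ) (u v : X → ℝ) :
    ∑ x, ∑ x', M x x' * (u x * v x') = u ⬝ᵥ M *ᵥ v := by
  simp only [dotProduct, mulVec, Finset.mul_sum]
  exact Finset.sum_congr rfl fun x _ => Finset.sum_congr rfl fun x' _ => by ring

theorem sum_sum_mul (u v : X → ℝ) : ∑ x, ∑ x', u x * v x' = (∑ x, u x) * ∑ x, v x :=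
  (Finset.sum_mul_sum _ _ _ _).symm

theorem sum_sum_gram_mul (F : Matrix X (Fin k) ℝ) (u v : X → ℝ) :
    ∑ x, ∑ x', (F x ⬝ᵥ F x') * (u x * v x') = (u ᵥ* F) ⬝ᵥ (v ᵥ* F) := by
  have h : ∀ x x', F x ⬝ᵥ F x' = (F * Fᵀ) x x' := fun x x' => rfl
  simp only [h]
  rw [sum_sum_mul_mul, ← mulVec_mulVec, dotProduct_mulVec, mulVec_transpose]

/-- The change of the loss under a rank-one perturbation of the factor. -/
theorem factorLoss_add_vecMulVec {M : Matrix X X ℝ} (hM : M.IsSymm) (F : Matrix X (Fin k) ℝ)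
    (v : X → ℝ) (b : Fin k → ℝ) :
    factorLoss M (F + vecMulVec v b) = factorLoss M F
      - 4 * (v ⬝ᵥ M *ᵥ (F *ᵥ b)) + 4 * ((v ᵥ* F) ⬝ᵥ ((F *ᵥ b) ᵥ* F))
      - 2 * (b ⬝ᵥ b) * (v ⬝ᵥ M *ᵥ v) + 2 * (b ⬝ᵥ b) * ((v ᵥ* F) ⬝ᵥ (v ᵥ* F))
      + 2 * (v ⬝ᵥ v) * ((F *ᵥ b) ⬝ᵥ (F *ᵥ b)) + 2 * (v ⬝ᵥ (F *ᵥ b)) ^ 2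
      + 4 * (b ⬝ᵥ b) * (v ⬝ᵥ (F *ᵥ b)) * (v ⬝ᵥ v) + (b ⬝ᵥ b) ^ 2 * (v ⬝ᵥ v) ^ 2 := by
  set q := F *ᵥ b with hq
  have hsymm : q ⬝ᵥ M *ᵥ v = v ⬝ᵥ M *ᵥ q := by
    rw [dotProduct_mulVec, ← mulVec_transpose, hM.eq, dotProduct_comm]
  have hgram : ∀ x x', (F + vecMulVec v b) x ⬝ᵥ (F + vecMulVec v b) x' =
      F x ⬝ᵥ F x' + (v x * q x' + q x * v x' + (b ⬝ᵥ b) * (v x * v x')) := by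
    intro x x'
    have h : ∀ z, (F + vecMulVec v b) z = F z + v z • b := fun z => by
      ext i; simp [vecMulVec_apply]
    have hqz : ∀ z, F z ⬝ᵥ b = q z := fun z => rfl
    rw [h, h, add_dotProduct, dotProduct_add, dotProduct_add, smul_dotProduct, dotProduct_smul,
      smul_dotProduct, dotProduct_smul, dotProduct_comm b (F x'), hqz, hqz]
    simp only [smul_eq_mul]
    ring
  have h1 : ∑ x, ∑ x', M x x' * ((F + vecMulVec v b) x ⬝ᵥ (F + vecMulVec v b) x') =
      ∑ x, ∑ x', M x x' * (F x ⬝ᵥ F x') + (2 * (v ⬝ᵥ M *ᵥ q) + (b ⬝ᵥ b) * (v ⬝ᵥ M *ᵥ v)) := by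
    have : 2 * (v ⬝ᵥ M *ᵥ q) + (b ⬝ᵥ b) * (v ⬝ᵥ M *ᵥ v) =
      v ⬝ᵥ M *ᵥ q + q ⬝ᵥ M *ᵥ v + (b ⬝ᵥ b) * (v ⬝ᵥ M *ᵥ v) := by rw [hsymm]; ring
    rw [this, ← sum_sum_mul_mul M v q, ← sum_sum_mul_mul M q v, ← sum_sum_mul_mul M v v]
    simp only [Finset.mul_sum, ← Finset.sum_add_distrib]
    exact Finset.sum_congr rfl fun x _ => Finset.sum_congr rfl fun x' _ => by
      rw [hgram]; ring
  have h2 : ∑ x, ∑ x', ((F + vecMulVec v b) x ⬝ᵥ (F + vecMulVec v b) x') ^ 2 =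
      ∑ x, ∑ x', (F x ⬝ᵥ F x') ^ 2
      + 4 * ((v ᵥ* F) ⬝ᵥ (q ᵥ* F)) + 2 * (b ⬝ᵥ b) * ((v ᵥ* F) ⬝ᵥ (v ᵥ* F))
      + 2 * (v ⬝ᵥ v) * (q ⬝ᵥ q) + 2 * (v ⬝ᵥ q) ^ 2
      + 4 * (b ⬝ᵥ b) * (v ⬝ᵥ q) * (v ⬝ᵥ v) + (b ⬝ᵥ b) ^ 2 * (v ⬝ᵥ v) ^ 2 := by
    -- With `s` for `b ⬝ᵥ b`, every term becomes a product of two sums over `X`, hence a double sum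
    -- comparable termwise with the expanded square.
    have e : ∀ s : ℝ, 4 * ((v ᵥ* F) ⬝ᵥ (q ᵥ* F)) + 2 * s * ((v ᵥ* F) ⬝ᵥ (v ᵥ* F))
      + 2 * (v ⬝ᵥ v) * (q ⬝ᵥ q) + 2 * (v ⬝ᵥ q) ^ 2
      + 4 * s * (v ⬝ᵥ q) * (v ⬝ᵥ v) + s ^ 2 * (v ⬝ᵥ v) ^ 2 =
      2 * ((v ᵥ* F) ⬝ᵥ (q ᵥ* F)) + 2 * ((q ᵥ* F) ⬝ᵥ (v ᵥ* F)) + 2 * s * ((v ᵥ* F) ⬝ᵥ (v ᵥ* F))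
      + ((∑ x, v x * v x) * (∑ x, q x * q x)) + ((∑ x, q x * q x) * (∑ x, v x * v x))
      + 2 * ((∑ x, v x * q x) * (∑ x, v x * q x))
      + 2 * s * ((∑ x, v x * q x) * (∑ x, v x * v x))
      + 2 * s * ((∑ x, v x * v x) * (∑ x, v x * q x))
      + s ^ 2 * ((∑ x, v x * v x) * (∑ x, v x * v x)) := by
      intro s
      rw [dotProduct_comm (q ᵥ* F)]
      simp only [dotProduct]
      ring
    simp only [add_assoc] at e ⊢
    rw [e]
    simp only [← sum_sum_gram_mul, ← sum_sum_mul]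
    simp only [Finset.mul_sum, ← Finset.sum_add_distrib]
    exact Finset.sum_congr rfl fun x _ => Finset.sum_congr rfl fun x' _ => by
      rw [hgram]; ring
  rw [factorLoss, h1, h2, factorLoss]
  ring

/-- First-order condition at a minimizer of the low-rank approximation loss. -/
theorem mulVec_mulVec_eq_of_minimizer {M : Matrix X X ℝ} (hM : M.IsSymm)
    {F : Matrix X (Fin k) ℝ} (hF : ∀ F' : Matrix X (Fin k) ℝ, factorLoss M F ≤ factorLoss M F') (b : Fin k → ℝ) :
    M *ᵥ (F *ᵥ b) = F *ᵥ ((F *ᵥ b) ᵥ* F) := by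
  have key : ∀ v : X → ℝ, v ⬝ᵥ M *ᵥ (F *ᵥ b) = (v ᵥ* F) ⬝ᵥ ((F *ᵥ b) ᵥ* F) := by
    intro v
    have h := fun t : ℝ => hF (F + vecMulVec (t • v) b)
    simp only [factorLoss_add_vecMulVec hM, smul_dotProduct, mulVec_smul, dotProduct_smul,
      smul_vecMul, smul_eq_mul] at h
    set L := v ⬝ᵥ M *ᵥ (F *ᵥ b) - (v ᵥ* F) ⬝ᵥ ((F *ᵥ b) ᵥ* F) with hL
    obtain ⟨c₂, hc₂⟩ : ∃ c, c = - 2 * (b ⬝ᵥ b) * (v ⬝ᵥ M *ᵥ v)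
      + 2 * (b ⬝ᵥ b) * ((v ᵥ* F) ⬝ᵥ (v ᵥ* F))
      + 2 * (v ⬝ᵥ v) * ((F *ᵥ b) ⬝ᵥ (F *ᵥ b)) + 2 * (v ⬝ᵥ (F *ᵥ b)) ^ 2 := ⟨_, rfl⟩
    obtain ⟨c₃, hc₃⟩ : ∃ c, c = 4 * (b ⬝ᵥ b) * (v ⬝ᵥ (F *ᵥ b)) * (v ⬝ᵥ v) := ⟨_, rfl⟩
    obtain ⟨c₄, hc₄⟩ : ∃ c, c = (b ⬝ᵥ b) ^ 2 * (v ⬝ᵥ v) ^ 2 := ⟨_, rfl⟩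
    -- Along `F + t v bᵀ` the loss is a quartic in `t`, minimal at `t = 0`, so its linear
    -- coefficient `-4 L` vanishes.
    have hpoly : ∀ t : ℝ, 0 ≤ t * (-4 * L + t * (c₂ + t * (c₃ + t * c₄))) := by
      intro t
      have := h t
      rw [hL, hc₂, hc₃, hc₄]
      nlinarith [this]
    have hcont : Continuous fun t : ℝ => -4 * L + t * (c₂ + t * (c₃ + t * c₄)) := by fun_prop
    have hmin : IsLocalMin (fun t : ℝ => t * (-4 * L + t * (c₂ + t * (c₃ + t * c₄)))) 0 :=
      Filter.Eventually.of_forall fun t => by simpa using hpoly t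
    have hder : HasDerivAt (fun t : ℝ => t * (-4 * L + t * (c₂ + t * (c₃ + t * c₄))))
        (-4 * L) 0 := by
      have h0 : HasDerivAt (fun t : ℝ => -4 * L + t * (c₂ + t * (c₃ + t * c₄)))
          (deriv (fun t : ℝ => -4 * L + t * (c₂ + t * (c₃ + t * c₄))) 0) 0 :=
        (by fun_prop : DifferentiableAt ℝ _ (0 : ℝ)).hasDerivAt
      refine ((hasDerivAt_id' (0 : ℝ)).mul h0).congr_deriv ?_
      simp
    have := hmin.hasDerivAt_eq_zero hder
    linarith
  refine dotProduct_eq _ _ fun v => ?_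
  rw [dotProduct_comm, key, dotProduct_comm (F *ᵥ _), dotProduct_mulVec]

theorem mulVec_eq_zero_of_dotProduct_mulVec_eq_zero {K : Matrix X X ℝ} (hK : K.PosSemidef)
    {v : X → ℝ} (hv : v ⬝ᵥ K *ᵥ v = 0) : K *ᵥ v = 0 := by
  simpa using (hK.dotProduct_mulVec_zero_iff v).1 (by simpa using hv)

theorem dotProduct_self_pos {ι : Type*} [Fintype ι] {v : ι → ℝ} (hv : v ≠ 0) : 0 < v ⬝ᵥ v := by
  simpa using dotProduct_star_self_pos_iff.2 hv

/-- A minimizer `F` of the rank-`k` approximation loss of `ν + K`, with `K` positive semidefinite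
of rank at most `k`, has the range of `K` inside its column space. -/
theorem exists_mulVec_eq_of_minimizer [DecidableEq X] {K : Matrix X X ℝ} (hK : K.PosSemidef)
    (hrank : K.rank ≤ k) {ν : ℝ} (hν : 0 < ν) {F : Matrix X (Fin k) ℝ}
    (hF : ∀ F' : Matrix X (Fin k) ℝ, factorLoss (ν • 1 + K) F ≤ factorLoss (ν • 1 + K) F') (z : X → ℝ) :
    ∃ b, F *ᵥ b = K *ᵥ z := by
  have hKs : K.IsSymm := by simpa using hK.1
  set M : Matrix X X ℝ := ν • 1 + K with hMdef
  have hM : M.IsSymm := (Matrix.isSymm_one.smul ν).add hKs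
  have hMv : ∀ v, M *ᵥ v = ν • v + K *ᵥ v := fun v => by
    rw [hMdef, add_mulVec, smul_mulVec, one_mulVec]
  have hstat := mulVec_mulVec_eq_of_minimizer hM hF
  by_contra hz
  have hz' : K *ᵥ z ∉ LinearMap.range F.mulVecLin := by
    rintro ⟨b, hb⟩
    exact hz ⟨b, hb⟩
  obtain ⟨φ, hφz, hφ⟩ := Submodule.exists_le_ker_of_notMem hz'
  -- `v` represents the functional `φ`
  obtain ⟨v, hv⟩ : ∃ v : X → ℝ, ∀ u, φ u = v ⬝ᵥ u := by
    refine ⟨fun x => φ (Pi.single x 1), fun u => ?_⟩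
    conv_lhs => rw [pi_eq_sum_univ' u]
    simp [dotProduct, mul_comm]
  have hvF : v ᵥ* F = 0 := by
    refine dotProduct_eq _ _ fun b => ?_
    rw [← dotProduct_mulVec, ← hv, zero_dotProduct]
    exact hφ ⟨b, rfl⟩
  have hKv : K *ᵥ v ≠ 0 := by
    intro h
    apply hφz
    rw [hv, dotProduct_mulVec, ← mulVec_transpose, hKs.eq, h, zero_dotProduct]
  have hv0 : v ≠ 0 := by
    rintro rfl
    simp at hKv
  have hvv := dotProduct_self_pos hv0
  have hvKv : 0 < v ⬝ᵥ K *ᵥ v := by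
    refine lt_of_le_of_ne (by simpa using hK.dotProduct_mulVec_nonneg v) fun h => hKv ?_
    exact mulVec_eq_zero_of_dotProduct_mulVec_eq_zero hK h.symm
  have hvMv : v ⬝ᵥ M *ᵥ v = ν * (v ⬝ᵥ v) + v ⬝ᵥ K *ᵥ v := by
    rw [hMv, dotProduct_add, dotProduct_smul, smul_eq_mul]
  -- a direction `b` whose feature `F b` is annihilated by `K`
  obtain ⟨b, hb0, hKFb⟩ : ∃ b, b ≠ 0 ∧ K *ᵥ (F *ᵥ b) = 0 := by
    by_contra hno
    push Not at hno
    -- Otherwise `K F` has rank `k`, at least that of `K`, so `K z = K F b` for some `b`;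
    -- stationarity rewrites this as `F (Fᵀ F b - ν b)`, in the column space after all.
    have hinj : Function.Injective (K * F).mulVecLin := by
      rw [← LinearMap.ker_eq_bot, LinearMap.ker_eq_bot']
      intro b hb
      by_contra hb0
      exact hno b hb0 (by simpa [mulVec_mulVec] using hb)
    have hle : LinearMap.range (K * F).mulVecLin ≤ LinearMap.range K.mulVecLin := by
      rintro _ ⟨b, rfl⟩
      exact ⟨F *ᵥ b, by simp⟩
    have heq : LinearMap.range (K * F).mulVecLin = LinearMap.range K.mulVecLin := by
      refine Submodule.eq_of_le_of_finrank_le hle ?_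
      rw [LinearMap.finrank_range_of_inj hinj]
      simpa [Matrix.rank] using hrank
    have hmem : K *ᵥ z ∈ LinearMap.range (K * F).mulVecLin := heq ▸ ⟨z, rfl⟩
    obtain ⟨b, hb⟩ := hmem
    refine hz ⟨(F *ᵥ b) ᵥ* F - ν • b, ?_⟩
    rw [mulVec_sub, ← hstat, hMv, mulVec_smul, add_sub_cancel_left, mulVec_mulVec]
    exact hb
  have hbb := dotProduct_self_pos hb0
  set w := F *ᵥ b with hw
  by_cases hw0 : w = 0
  · -- an unused feature direction can be devoted to `v`
    -- This `t` minimizes the change of loss `-2 t² |b|² (v ⬝ᵥ M v) + t⁴ |b|⁴ |v|⁴`.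
    obtain ⟨t, ht⟩ : ∃ t : ℝ, t ^ 2 * ((b ⬝ᵥ b) * (v ⬝ᵥ v) ^ 2) = v ⬝ᵥ M *ᵥ v := by
      refine ⟨√((v ⬝ᵥ M *ᵥ v) / ((b ⬝ᵥ b) * (v ⬝ᵥ v) ^ 2)), ?_⟩
      rw [Real.sq_sqrt (by rw [hvMv]; positivity)]
      field_simp
    have hpos : 0 < v ⬝ᵥ M *ᵥ v := by rw [hvMv]; positivity
    have ht2 : 0 < t ^ 2 := by
      rcases (sq_nonneg t).eq_or_lt with h | h
      · rw [← h, zero_mul] at ht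
        exact absurd ht hpos.ne
      · exact h
    have h := hF (F + vecMulVec (t • v) b)
    rw [factorLoss_add_vecMulVec hM] at h
    simp only [← hw, hw0, smul_dotProduct, mulVec_smul, dotProduct_smul, smul_vecMul, smul_eq_mul,
      hvF, mulVec_zero, dotProduct_zero, zero_vecMul] at h
    have h3 : (b ⬝ᵥ b) ^ 2 * (t * (t * (v ⬝ᵥ v))) ^ 2 =
        t ^ 2 * (b ⬝ᵥ b) * (v ⬝ᵥ M *ᵥ v) := by
      rw [← ht]; ring
    rw [h3] at h
    have : 0 < t ^ 2 * (b ⬝ᵥ b) * (v ⬝ᵥ M *ᵥ v) := by positivity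
    nlinarith
  · -- the feature `w` can be traded for `v`
    have hww := dotProduct_self_pos hw0
    -- Scaled so that `t v` has the same norm as `w`.
    obtain ⟨t, ht⟩ : ∃ t : ℝ, t ^ 2 * (v ⬝ᵥ v) = w ⬝ᵥ w := by
      refine ⟨√((w ⬝ᵥ w) / (v ⬝ᵥ v)), ?_⟩
      rw [Real.sq_sqrt (by positivity)]
      field_simp
    have hMw : M *ᵥ w = ν • w := by rw [hMv, hKFb, add_zero]
    set τ := w ⬝ᵥ w with hτ
    have hvw : v ⬝ᵥ w = 0 := by rw [hw, dotProduct_mulVec, hvF, zero_dotProduct]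
    have hwv : w ⬝ᵥ v = 0 := by rw [dotProduct_comm, hvw]
    set a := w ᵥ* F with ha
    have hFa : F *ᵥ a = ν • w := by rw [ha, ← hstat, hMw]
    have haa : a ⬝ᵥ a = ν * τ := by
      nth_rewrite 1 [ha]
      rw [← dotProduct_mulVec, hFa, dotProduct_smul, smul_eq_mul]
    -- `F - τ⁻¹ w aᵀ` is `F` with its component along `w` projected out; that component is put along
    -- `t v` instead. Both `M` and `F Fᵀ` have eigenvalue `ν` at `w`, while the Rayleigh quotient of
    -- `M` at `v` exceeds `ν`, so the loss strictly drops.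
    have h := hF (F + vecMulVec (t • v - w) (τ⁻¹ • a))
    rw [factorLoss_add_vecMulVec hM] at h
    have hwMv : w ⬝ᵥ M *ᵥ v = 0 := by
      rw [dotProduct_mulVec, ← mulVec_transpose, hM.eq, hMw, smul_dotProduct, hwv, smul_zero]
    simp only [mulVec_smul, hFa, smul_dotProduct, dotProduct_smul, smul_vecMul, smul_eq_mul,
      sub_vecMul, mulVec_sub, sub_dotProduct, dotProduct_sub, hvF, hMw, smul_zero, zero_sub,
      neg_dotProduct, dotProduct_neg, ← ha, haa, hvw, hwv, hwMv, ← hτ] at h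
    have hτ0 : τ ≠ 0 := hww.ne'
    have h4 : t * (t * (v ⬝ᵥ v)) = τ := by rw [← ht]; ring
    have h5 : t * (t * (v ⬝ᵥ M *ᵥ v)) = ν * τ + t ^ 2 * (v ⬝ᵥ K *ᵥ v) := by
      rw [hvMv, ← ht]; ring
    have ht2 : 0 < t ^ 2 := by
      rcases (sq_nonneg t).eq_or_lt with h | h
      · rw [← h, zero_mul] at ht
        exact absurd ht hww.ne
      · exact h
    simp only [mul_zero, sub_zero, zero_sub, h4, h5, mul_sub] at h
    field_simp at h
    ring_nf at h
    have : 0 < ν * (t ^ 2 * (v ⬝ᵥ K *ᵥ v)) := by positivity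
    linarith

end LowRankApproximation

/-! ### The similarity matrix and majority labels of the classes -/

section SimilarityGraph

theorem similarity_eq {X : Type*} [DecidableEq X] {m : ℕ} (cls : X → Fin m) (α β : ℝ) (x x' : X) :
    similarity cls α β x x' = (1 - α) * (if x = x' then 1 else 0)
      + (α - β) * (if cls x = cls x' then 1 else 0) + β := by
  unfold similarity
  by_cases h : x = x'
  · subst h; simp
  · simp only [h, if_false]
    split_ifs <;> ring

/-- The class-block part of the similarity matrix. -/
def blockMatrix {X : Type*} {m : ℕ} (cls : X → Fin m) (a b : ℝ) : Matrix X X ℝ :=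
  of fun x x' => a * (if cls x = cls x' then 1 else 0) + b

/-- Exhibits both summands as Gram matrices, from which positive semidefiniteness is read off. -/
theorem blockMatrix_eq {X : Type*} {m : ℕ} (cls : X → Fin m) (a b : ℝ) :
    blockMatrix cls a b = a • ((of fun x c => if cls x = c then (1 : ℝ) else 0) *
      (of fun x c => if cls x = c then (1 : ℝ) else 0)ᴴ) + b • vecMulVec 1 (star 1) := by
  ext x x'
  simp only [blockMatrix, of_apply, Matrix.add_apply, Matrix.smul_apply, mul_apply, conjTranspose_apply,
    star_trivial, vecMulVec_apply, ite_mul, one_mul, zero_mul, Finset.sum_ite_eq,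
    Finset.mem_univ, if_true, smul_eq_mul, Pi.one_apply, mul_one,
    eq_comm (a := cls x')]

variable {X : Type*} [Fintype X] {m n : ℕ}

theorem card_eq_mul_of_card_fiber_eq {cls : X → Fin m}
    (hcls : ∀ c, (Finset.univ.filter fun x : X => cls x = c).card = n) :
    Fintype.card X = m * n := by
  rw [← Finset.card_univ, Finset.card_eq_sum_card_fiberwise (f := cls) (t := Finset.univ)
    (fun x _ => Finset.mem_coe.2 (Finset.mem_univ _))]
  simp [hcls]

theorem sum_boole_eq_of_card_fiber_eq {cls : X → Fin m}
    (hcls : ∀ c, (Finset.univ.filter fun x : X => cls x = c).card = n) (c : Fin m) :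
    ∑ x, (if c = cls x then (1 : ℝ) else 0) = n := by
  rw [Finset.sum_boole, ← hcls c]
  simp only [eq_comm]

/-- Equal class sizes make the row sums independent of the sample; this is why the marginal is
uniform. -/
theorem sum_similarity [DecidableEq X] {cls : X → Fin m}
    (hcls : ∀ c, (Finset.univ.filter fun x : X => cls x = c).card = n) (α β : ℝ) (x : X) :
    ∑ x', similarity cls α β x x' = (1 - α) + (α - β) * n + β * (m * n) := by
  simp only [similarity_eq, Finset.sum_add_distrib, ← Finset.mul_sum,
    sum_boole_eq_of_card_fiber_eq hcls]
  simp [card_eq_mul_of_card_fiber_eq hcls]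
  ring

theorem sum_sum_similarity [DecidableEq X] {cls : X → Fin m}
    (hcls : ∀ c, (Finset.univ.filter fun x : X => cls x = c).card = n) (α β : ℝ) :
    ∑ u, ∑ v, similarity cls α β u v = m * n * ((1 - α) + (α - β) * n + β * (m * n)) := by
  simp only [sum_similarity hcls, Finset.sum_const, Finset.card_univ,
    card_eq_mul_of_card_fiber_eq hcls, nsmul_eq_mul, Nat.cast_mul]

/-- The marginal of the idealized similarity graph is uniform. -/
theorem IsSimilarityGraph.augMarginal_eq {N : Type*} [MeasurableSpace N] [MeasurableSpace X]
    [DecidableEq X] {P : Measure N} {A : Kernel N X} {cls : X → Fin m}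
    (hcls : ∀ c, (Finset.univ.filter fun x : X => cls x = c).card = n) {α β : ℝ}
    (hD : (1 - α) + (α - β) * n + β * (m * n) ≠ 0)
    (hgraph : IsSimilarityGraph P A cls α β) (x : X) : augMarginal P A x = 1 / (m * n) := by
  rw [augMarginal, Finset.sum_congr rfl fun x' _ => hgraph x x', ← Finset.sum_div,
    sum_similarity hcls, sum_sum_similarity hcls, one_div, div_mul_cancel_right₀ hD]

theorem blockMatrix_posSemidef (cls : X → Fin m) {a b : ℝ} (ha : 0 ≤ a) (hb : 0 ≤ b) :
    (blockMatrix cls a b).PosSemidef := by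
  rw [blockMatrix_eq]
  exact ((posSemidef_self_mul_conjTranspose _).smul ha).add
    ((posSemidef_vecMulVec_self_star _).smul hb)

/-- Rows depend only on the class, so the matrix factors through `Fin m`. -/
theorem blockMatrix_rank_le (cls : X → Fin m) (a b : ℝ) : (blockMatrix cls a b).rank ≤ m := by
  have h : blockMatrix cls a b = (of fun x c => if cls x = c then (1 : ℝ) else 0) *
      (of fun c x' => a * (if c = cls x' then (1 : ℝ) else 0) + b) := by
    ext x x'
    simp [blockMatrix, mul_apply]
  rw [h]
  exact (rank_mul_le_left _ _).trans ((rank_le_card_width _).trans (by simp))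

/-- Every class-constant function lies in the range of the block matrix. -/
theorem exists_blockMatrix_mulVec_eq {cls : X → Fin m} (hn : 0 < n)
    (hcls : ∀ c, (Finset.univ.filter fun x : X => cls x = c).card = n) {a b : ℝ} (ha : 0 < a)
    (hb : 0 ≤ b) (t : Fin m → ℝ) : ∃ z, blockMatrix cls a b *ᵥ z = t ∘ cls := by
  have hn' : (0 : ℝ) < n := by exact_mod_cast hn
  have hcard : ∑ x, t (cls x) = n * ∑ c, t c := by
    rw [← Finset.sum_fiberwise Finset.univ cls, Finset.mul_sum]
    refine Finset.sum_congr rfl fun c _ => ?_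
    rw [Finset.sum_congr rfl fun x hx => by rw [(Finset.mem_filter.1 hx).2], Finset.sum_const,
      hcls, nsmul_eq_mul]
  have hd : a * n + b * (m * n) ≠ 0 := by positivity
  -- The shift `e` compensates for the constant part `b`: the ansatz `(a n)⁻¹ (t - e)` works exactly
  -- when `e (a n + b m n) = b n ∑ t`.
  set e := b * n * (∑ c, t c) / (a * n + b * (m * n)) with he
  refine ⟨fun x => (a * n)⁻¹ * (t (cls x) - e), ?_⟩
  ext x
  have h1 : ∑ x', (if cls x = cls x' then (1 : ℝ) else 0) * (t (cls x') - e) =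
      n * (t (cls x) - e) := by
    rw [← sum_boole_eq_of_card_fiber_eq hcls (cls x), Finset.sum_mul]
    refine Finset.sum_congr rfl fun x' _ => ?_
    split_ifs with h
    · rw [h]
    · simp
  have h2 : ∑ x', (t (cls x') - e) = n * ∑ c, t c - m * n * e := by
    rw [Finset.sum_sub_distrib, hcard]
    simp [card_eq_mul_of_card_fiber_eq hcls]
  have h3 : (blockMatrix cls a b *ᵥ fun x => (a * n)⁻¹ * (t (cls x) - e)) x =
      (a * n)⁻¹ * (a * ∑ x', (if cls x = cls x' then (1 : ℝ) else 0) * (t (cls x') - e)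
        + b * ∑ x', (t (cls x') - e)) := by
    simp only [mulVec, dotProduct, blockMatrix, of_apply, Finset.mul_sum,
      ← Finset.sum_add_distrib]
    exact Finset.sum_congr rfl fun x' _ => by ring
  rw [h3, h1, h2, Function.comp_apply]
  have h4 : e * (a + b * m) = b * ∑ c, t c := by
    refine mul_right_cancel₀ hn'.ne' ?_
    linear_combination (div_mul_cancel₀ (b * n * ∑ c, t c) hd : e * _ = _)
  field_simp
  linarith

/-- Inconsistency of a labelling `g` along the edges of the similarity graph dominates its
inconsistency with the best labelling of the classes. -/
theorem exists_sum_ne_le_sum_similarity [DecidableEq X] {cls : X → Fin m}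
    (hcls : ∀ c, (Finset.univ.filter fun x : X => cls x = c).card = n) {α β : ℝ} (hβ : 0 ≤ β)
    (hβα : β ≤ α) (g : X → Fin m) :
    ∃ σ : Fin m → Fin m, n * ((α - β) + m * β) * ∑ x, (if σ (cls x) ≠ g x then (1 : ℝ) else 0) ≤
      ∑ x, ∑ x', similarity cls α β x x' * (if g x ≠ g x' then 1 else 0) := by
  -- `p c i` counts the samples of class `c` that `g` labels `i`; `σ c` will be a most frequent
  -- label.
  set p : Fin m → Fin m → ℝ := fun c i =>
    ∑ x, (if c = cls x then (1 : ℝ) else 0) * (if i = g x then 1 else 0) with hp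
  have hp0 : ∀ c i, 0 ≤ p c i := fun c i => Finset.sum_nonneg fun x _ => by positivity
  have hpsum : ∀ c, ∑ i, p c i = n := by
    intro c
    rw [hp, Finset.sum_comm]
    simp [← sum_boole_eq_of_card_fiber_eq hcls c]
  have hmax : ∀ c, ∃ i, ∀ j, p c j ≤ p c i := fun c =>
    haveI : Nonempty (Fin m) := ⟨c⟩
    Finite.exists_max (p c)
  choose σ hσ using hmax
  refine ⟨σ, ?_⟩
  -- `V c` counts the ordered pairs inside class `c` on which `g` disagrees; it is at least `n`
  -- times the number of minority samples.
  set V : Fin m → ℝ := fun c => (n : ℝ) ^ 2 - p c ⬝ᵥ p c with hV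
  have hVσ : ∀ c, n * (n - p c (σ c)) ≤ V c := by
    intro c
    have : p c ⬝ᵥ p c ≤ p c (σ c) * n := by
      rw [← hpsum c, Finset.mul_sum]
      exact Finset.sum_le_sum fun i _ => mul_le_mul_of_nonneg_right (hσ c i) (hp0 c i)
    simp only [hV]
    linarith
  have herr : ∑ x, (if σ (cls x) ≠ g x then (1 : ℝ) else 0) = ∑ c, (n - p c (σ c)) := by
    have h1 : ∀ x, (if σ (cls x) ≠ g x then (1 : ℝ) else 0) =
        ∑ c, ((if c = cls x then (1 : ℝ) else 0) -
          (if c = cls x then (1 : ℝ) else 0) * (if σ c = g x then 1 else 0)) := by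
      intro x
      rw [Finset.sum_eq_single (cls x) (fun c _ hc => by simp [hc]) (by simp)]
      by_cases h : σ (cls x) = g x <;> simp [h]
    simp only [h1]
    rw [Finset.sum_comm]
    refine Finset.sum_congr rfl fun c _ => ?_
    rw [Finset.sum_sub_distrib, sum_boole_eq_of_card_fiber_eq hcls]
  have hpair : ∀ c d, ∑ x, ∑ x', (if c = cls x then (1 : ℝ) else 0) *
      (if d = cls x' then 1 else 0) * (if g x ≠ g x' then 1 else 0) =
      (n : ℝ) ^ 2 - p c ⬝ᵥ p d := by
    intro c d
    have h1 : ∀ x x', (if g x ≠ g x' then (1 : ℝ) else 0) =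
        1 - ∑ i, (if i = g x then (1 : ℝ) else 0) * (if i = g x' then 1 else 0) := by
      intro x x'
      simp only [ite_mul, one_mul, zero_mul, Finset.sum_ite_eq', Finset.mem_univ, if_true]
      split_ifs <;> simp_all
    have h2 : p c ⬝ᵥ p d = ∑ x, ∑ x', (if c = cls x then (1 : ℝ) else 0) *
        (if d = cls x' then 1 else 0) *
        ∑ i, (if i = g x then (1 : ℝ) else 0) * (if i = g x' then 1 else 0) := by
      simp only [dotProduct, hp, Finset.sum_mul_sum]
      simp only [Finset.mul_sum]
      rw [Finset.sum_comm]
      refine Finset.sum_congr rfl fun x _ => ?_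
      rw [Finset.sum_comm]
      exact Finset.sum_congr rfl fun x' _ => Finset.sum_congr rfl fun i _ => by ring
    rw [h2, sq]
    nth_rewrite 1 [← sum_boole_eq_of_card_fiber_eq hcls c]
    rw [← sum_boole_eq_of_card_fiber_eq hcls d, Finset.sum_mul_sum, ← Finset.sum_sub_distrib]
    refine Finset.sum_congr rfl fun x _ => ?_
    rw [← Finset.sum_sub_distrib]
    refine Finset.sum_congr rfl fun x' _ => ?_
    rw [h1]
    ring
  -- Disagreeing pairs across two classes are at least the average of those within them, so the
  -- `β`-edges contribute to the gap too.
  have hcross : ∀ c d, (V c + V d) / 2 ≤ (n : ℝ) ^ 2 - p c ⬝ᵥ p d := by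
    intro c d
    have : 2 * (p c ⬝ᵥ p d) ≤ p c ⬝ᵥ p c + p d ⬝ᵥ p d := by
      simp only [dotProduct, Finset.mul_sum, ← Finset.sum_add_distrib]
      exact Finset.sum_le_sum fun i _ => by nlinarith [sq_nonneg (p c i - p d i)]
    simp only [hV]
    linarith
  -- The identity part of the similarity drops out, since `g x ≠ g x` never holds.
  have htotal : ∑ x, ∑ x', similarity cls α β x x' * (if g x ≠ g x' then 1 else 0) =
      ∑ c, ∑ d, ((α - β) * (if c = d then 1 else 0) + β) * ((n : ℝ) ^ 2 - p c ⬝ᵥ p d) := by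
    simp only [← hpair, Finset.mul_sum]
    have h1 : ∀ x x', similarity cls α β x x' * (if g x ≠ g x' then 1 else 0) =
        ∑ c, ∑ d, ((α - β) * (if c = d then 1 else 0) + β) *
          ((if c = cls x then (1 : ℝ) else 0) *
            (if d = cls x' then 1 else 0) * (if g x ≠ g x' then 1 else 0)) := by
      intro x x'
      rw [Finset.sum_eq_single (cls x) (fun c _ hc => by simp [hc]) (by simp),
        Finset.sum_eq_single (cls x') (fun d _ hd => by simp [hd]) (by simp), similarity_eq]
      by_cases h : x = x' <;> simp [h]
    simp only [h1]
    rw [Finset.sum_congr rfl fun x _ => Finset.sum_comm, Finset.sum_comm]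
    refine Finset.sum_congr rfl fun c _ => ?_
    rw [Finset.sum_congr rfl fun x _ => Finset.sum_comm, Finset.sum_comm]
  have hlow : ∑ c, ∑ d, ((α - β) * (if c = d then 1 else 0) + β) * ((V c + V d) / 2) =
      ((α - β) + m * β) * ∑ c, V c := by
    have h1 : ∀ c d, ((α - β) * (if c = d then 1 else 0) + β) * ((V c + V d) / 2) =
        (if c = d then (α - β) * V c else 0) + (β / 2 * V c + β / 2 * V d) := by
      intro c d
      split_ifs with h
      · subst h; ring
      · ring
    simp only [h1, Finset.sum_add_distrib, Finset.sum_ite_eq, Finset.mem_univ, if_true,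
      Finset.sum_const, Finset.card_univ, Fintype.card_fin, nsmul_eq_mul, ← Finset.mul_sum]
    ring
  have hc0 : 0 ≤ (α - β) + m * β := by
    have : 0 ≤ (m : ℝ) * β := by positivity
    linarith
  calc n * ((α - β) + m * β) * ∑ x, (if σ (cls x) ≠ g x then (1 : ℝ) else 0)
      = ((α - β) + m * β) * ∑ c, n * (n - p c (σ c)) := by rw [herr, ← Finset.mul_sum]; ring
    _ ≤ ((α - β) + m * β) * ∑ c, V c :=
        mul_le_mul_of_nonneg_left (Finset.sum_le_sum fun c _ => hVσ c) hc0
    _ ≤ _ := by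
        rw [← hlow, htotal]
        refine Finset.sum_le_sum fun c _ => Finset.sum_le_sum fun d _ =>
          mul_le_mul_of_nonneg_left (hcross c d) ?_
        split_ifs <;> linarith

end SimilarityGraph

/-! ### Augmentation probabilities as finite sums -/

section Probability

variable {N X : Type*} [MeasurableSpace N] [MeasurableSpace X]

theorem measurable_kernel_singleton [MeasurableSingletonClass X] (A : Kernel N X) (x : X) :
    Measurable fun z => (A z).real {x} :=
  (A.measurable_coe (measurableSet_singleton x)).ennreal_toReal

theorem integrable_of_measurable_of_mem_Icc (P : Measure N) [IsProbabilityMeasure P] {h : N → ℝ} (hm : Measurable h)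
    (h01 : ∀ z, h z ∈ Set.Icc (0 : ℝ) 1) : Integrable h P :=
  Integrable.of_bound hm.aestronglyMeasurable 1 (Filter.Eventually.of_forall fun z => by
    rw [Real.norm_of_nonneg (h01 z).1]; exact (h01 z).2)

theorem kernel_real_mem_Icc (A : Kernel N X) [IsMarkovKernel A] (z : N) (s : Set X) : (A z).real s ∈ Set.Icc (0 : ℝ) 1 :=
  ⟨measureReal_nonneg, measureReal_le_one⟩

theorem integrable_kernel_mul_boole [MeasurableSingletonClass X] {m : ℕ} (P : Measure N)
    [IsProbabilityMeasure P] (A : Kernel N X) [IsMarkovKernel A] {y : N → Fin m} (hy : Measurable y) (g : X → Fin m) (x : X) :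
    Integrable (fun z => (A z).real {x} * (if g x ≠ y z then 1 else 0)) P := by
  refine integrable_of_measurable_of_mem_Icc P ((measurable_kernel_singleton A x).mul
    (Measurable.ite (measurableSet_eq_fun measurable_const hy).compl measurable_const
      measurable_const)) fun z => ?_
  have h := kernel_real_mem_Icc A z {x}
  split_ifs <;> simp [h.1, h.2]

variable [Fintype X] [MeasurableSingletonClass X] {m : ℕ} (P : Measure N) (A : Kernel N X)

theorem sum_kernel_singleton [IsMarkovKernel A] (z : N) : ∑ x, (A z).real {x} = 1 := by
  rw [sum_measureReal_singleton]
  simp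

theorem measurableSet_label_ne {y : N → Fin m} (hy : Measurable y) (g : X → Fin m) :
    MeasurableSet {p : N × X | g p.2 ≠ y p.1} :=
  (measurableSet_eq_fun ((measurable_of_finite g).comp measurable_snd)
    (hy.comp measurable_fst)).compl

variable [IsProbabilityMeasure P] [IsMarkovKernel A]

/-- Summing over the second view integrates it out, as `A z` has mass one. -/
theorem augMarginal_eq (x : X) : augMarginal P A x = ∫ z, (A z).real {x} ∂P := by
  unfold augMarginal augWeight
  rw [← integral_finsetSum]
  · refine integral_congr_ae (Filter.Eventually.of_forall fun z => ?_)
    simp only [← Finset.mul_sum, sum_kernel_singleton, mul_one]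
  · intro x' _
    refine integrable_of_measurable_of_mem_Icc P
      ((measurable_kernel_singleton A x).mul (measurable_kernel_singleton A x')) fun z => ?_
    have h := kernel_real_mem_Icc A z {x}
    have h' := kernel_real_mem_Icc A z {x'}
    exact ⟨mul_nonneg h.1 h'.1, mul_le_one₀ h.2 h'.1 h'.2⟩

open Classical in
/-- The probability of an event under `P ⊗ₘ A`, as a finite sum of integrals. -/
theorem real_compProd_eq_integral {S : Set (N × X)} (hS : MeasurableSet S) :
    (P ⊗ₘ A).real S = ∫ z, ∑ x, (A z).real {x} * (if (z, x) ∈ S then 1 else 0) ∂P := by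
  have h : ∀ z, ∑ x, (A z).real {x} * (if (z, x) ∈ S then 1 else 0) =
      (A z).real (Prod.mk z ⁻¹' S) := by
    intro z
    simp only [mul_ite, mul_one, mul_zero]
    rw [← Finset.sum_filter, sum_measureReal_singleton]
    congr 1
    ext x
    simp
  simp only [h]
  rw [integral_eq_lintegral_of_nonneg_ae (Filter.Eventually.of_forall fun z => measureReal_nonneg)
    (Kernel.measurable_kernel_prodMk_left hS).ennreal_toReal.aestronglyMeasurable,
    measureReal_def, Measure.compProd_apply hS]
  simp

/-- Two views of one datum receive different labels with at most twice the probability of a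
label error. -/
theorem sum_augWeight_ne_le {y : N → Fin m} (hy : Measurable y) (g : X → Fin m) :
    ∑ x, ∑ x', augWeight P A x x' * (if g x ≠ g x' then 1 else 0) ≤
      2 * (P ⊗ₘ A).real {p | g p.2 ≠ y p.1} := by
  have hint : ∀ x x', Integrable
      (fun z => (A z).real {x} * (A z).real {x'} * (if g x ≠ g x' then (1 : ℝ) else 0)) P := by
    intro x x'
    refine (integrable_of_measurable_of_mem_Icc P
      ((measurable_kernel_singleton A x).mul (measurable_kernel_singleton A x'))
      fun z => ?_).mul_const _
    have h := kernel_real_mem_Icc A z {x}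
    have h' := kernel_real_mem_Icc A z {x'}
    exact ⟨mul_nonneg h.1 h'.1, mul_le_one₀ h.2 h'.1 h'.2⟩
  have hlhs : ∑ x, ∑ x', augWeight P A x x' * (if g x ≠ g x' then 1 else 0) =
      ∫ z, ∑ x, ∑ x', (A z).real {x} * (A z).real {x'} * (if g x ≠ g x' then 1 else 0) ∂P := by
    rw [integral_finsetSum _ fun x _ => integrable_finsetSum _ fun x' _ => hint x x']
    refine Finset.sum_congr rfl fun x _ => ?_
    rw [integral_finsetSum _ fun x' _ => hint x x']
    exact Finset.sum_congr rfl fun x' _ => by rw [integral_mul_const, augWeight]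
  rw [hlhs, real_compProd_eq_integral P A (measurableSet_label_ne hy g), ← integral_const_mul]
  refine integral_mono (integrable_finsetSum _ fun x _ => integrable_finsetSum _ fun x' _ =>
    hint x x') ?_ fun z => ?_
  · refine (integrable_finsetSum _ fun x _ => ?_).const_mul 2
    simpa using integrable_kernel_mul_boole P A hy g x
  · simp only [Set.mem_ofPred_eq]
    set q : X → ℝ := fun x => (A z).real {x} with hq
    have hq0 : ∀ x, 0 ≤ q x := fun x => measureReal_nonneg
    have hq1 : ∑ x, q x = 1 := sum_kernel_singleton A z
    set E : X → ℝ := fun x => if g x ≠ y z then 1 else 0 with hE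
    -- Since `q` sums to one, the error doubles into a sum over pairs; then `g x ≠ g x'` forces an
    -- error in at least one of the two views.
    have hsplit : 2 * ∑ x, q x * E x = ∑ x, ∑ x', q x * q x' * (E x + E x') := by
      have : 2 * ∑ x, q x * E x =
          (∑ x, q x * E x) * ∑ x, q x + (∑ x, q x) * ∑ x, q x * E x := by rw [hq1]; ring
      rw [this, Finset.sum_mul_sum, Finset.sum_mul_sum]
      simp only [← Finset.sum_add_distrib]
      exact Finset.sum_congr rfl fun x _ => Finset.sum_congr rfl fun x' _ => by ring
    refine le_trans ?_ (le_of_eq (hsplit.symm.trans (by simp [hq, hE])))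
    refine Finset.sum_le_sum fun x _ => Finset.sum_le_sum fun x' _ =>
      mul_le_mul_of_nonneg_left ?_ (mul_nonneg (hq0 x) (hq0 x'))
    simp only [hE]
    split_ifs <;> simp_all

/-- The law of an augmented sample gives the probability that two labellings disagree. -/
theorem real_compProd_ne_eq (g g' : X → Fin m) :
    (P ⊗ₘ A).real {p | g' p.2 ≠ g p.2} =
      ∑ x, augMarginal P A x * (if g' x ≠ g x then 1 else 0) := by
  have hS : MeasurableSet {p : N × X | g' p.2 ≠ g p.2} :=
    (measurableSet_eq_fun ((measurable_of_finite g').comp measurable_snd)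
      ((measurable_of_finite g).comp measurable_snd)).compl
  rw [real_compProd_eq_integral P A hS, integral_finsetSum]
  · refine Finset.sum_congr rfl fun x _ => ?_
    rw [augMarginal_eq, ← integral_mul_const]
    simp
  · intro x _
    refine ((integrable_of_measurable_of_mem_Icc P (measurable_kernel_singleton A x)
      fun z => kernel_real_mem_Icc A z {x}).mul_const (if g' x ≠ g x then 1 else 0)).congr
      (Filter.Eventually.of_forall fun z => ?_)
    simp

end Probability

/-! ### From the loss to the linear probing error -/

/-- When the marginal is uniform, the spectral contrastive loss is a multiple of the low-rank
approximation loss of the rescaled weight matrix. -/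
theorem sq_mul_spectralLoss_eq {N X : Type*} [MeasurableSpace N] [MeasurableSpace X] [Fintype X]
    {P : Measure N} {A : Kernel N X} {k : ℕ} {T : ℝ} (hT : T ≠ 0)
    (hw : ∀ x, augMarginal P A x = 1 / T) (f : X → Fin k → ℝ) :
    T ^ 2 * spectralLoss P A f = factorLoss (of fun x x' => T ^ 2 * augWeight P A x x') f := by
  simp only [spectralLoss, factorLoss, hw, of_apply]
  rw [mul_add]
  congr 1
  · simp only [Finset.mul_sum]
    exact Finset.sum_congr rfl fun x _ => Finset.sum_congr rfl fun x' _ => by ring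
  · simp only [Finset.mul_sum]
    exact Finset.sum_congr rfl fun x _ => Finset.sum_congr rfl fun x' _ => by field_simp

/-- A global minimizer of the spectral contrastive loss on the idealized similarity graph
linearly represents every class-constant function. -/
theorem exists_dotProduct_eq_of_minimizer {N X : Type*} [MeasurableSpace N] [MeasurableSpace X]
    [Fintype X] [DecidableEq X] {P : Measure N} {A : Kernel N X} {m n k : ℕ} (hmk : m ≤ k)
    (hn : 0 < n) (hm : 0 < m) {cls : X → Fin m}
    (hcls : ∀ c, (Finset.univ.filter fun x : X => cls x = c).card = n) {α β : ℝ} (hβ : 0 ≤ β)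
    (hβα : β < α) (hα : α < 1) (hgraph : IsSimilarityGraph P A cls α β) {f : X → Fin k → ℝ}
    (hf : ∀ f' : X → Fin k → ℝ, spectralLoss P A f ≤ spectralLoss P A f') (t : Fin m → ℝ) :
    ∃ b, ∀ x, f x ⬝ᵥ b = t (cls x) := by
  have hn' : (0 : ℝ) < n := by exact_mod_cast hn
  have hm' : (0 : ℝ) < m := by exact_mod_cast hm
  obtain ⟨D, hD⟩ : ∃ D : ℝ, D = (1 - α) + (α - β) * n + β * (m * n) := ⟨_, rfl⟩
  have hD0 : 0 < D := by
    have h1 : 0 < (α - β) * n := mul_pos (by linarith) hn'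
    have h2 : 0 ≤ β * (m * n) := by positivity
    linarith
  obtain ⟨T, hT⟩ : ∃ T : ℝ, T = m * n := ⟨_, rfl⟩
  have hT0 : 0 < T := hT ▸ mul_pos hm' hn'
  have hsum : ∑ u, ∑ v, similarity cls α β u v = T * D := by
    rw [sum_sum_similarity hcls, hT, hD]
  have hw : ∀ x, augMarginal P A x = 1 / T := fun x => by
    rw [hgraph.augMarginal_eq hcls (hD ▸ hD0.ne'), hT]
  -- The split `ν I + K`, with `ν = (T / D) (1 - α)`.
  have hM : (of fun x x' => T ^ 2 * augWeight P A x x') =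
      (T / D * (1 - α)) • (1 : Matrix X X ℝ) +
        blockMatrix cls (T / D * (α - β)) (T / D * β) := by
    ext x x'
    rw [of_apply, hgraph x x', hsum]
    simp only [of_apply, similarity_eq, Matrix.add_apply, Matrix.smul_apply,
      one_apply, blockMatrix, smul_eq_mul]
    field_simp
    ring
  have hTD : 0 < T / D := by positivity
  have ha : 0 < T / D * (α - β) := mul_pos hTD (by linarith)
  have hb : 0 ≤ T / D * β := by positivity
  obtain ⟨z, hz⟩ := exists_blockMatrix_mulVec_eq hn hcls ha hb t
  obtain ⟨b, hb'⟩ := exists_mulVec_eq_of_minimizer (F := f)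
    (blockMatrix_posSemidef cls ha.le hb) ((blockMatrix_rank_le cls _ _).trans hmk)
    (mul_pos hTD (by linarith : 0 < 1 - α)) (fun F' => by
      have h := fun F'' : X → Fin k → ℝ => sq_mul_spectralLoss_eq hT0.ne' hw F''
      rw [← hM]
      refine (h f).symm.trans_le (le_trans ?_ (h F').le)
      exact mul_le_mul_of_nonneg_left (hf F') (sq_nonneg T)) z
  exact ⟨b, fun x => (congrFun (hb'.trans hz) x :)⟩

/-- On the idealized similarity graph, some relabelling of the classes agrees with a labelling
of error `ε` up to the edge inconsistency over the spectral gap. -/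
theorem exists_real_compProd_class_label_ne_le {N X : Type*} [MeasurableSpace N]
    [MeasurableSpace X] [MeasurableSingletonClass X] [Fintype X] [DecidableEq X]
    (P : Measure N) [IsProbabilityMeasure P] (A : Kernel N X) [IsMarkovKernel A] {m n : ℕ}
    (hn : 0 < n) (hm : 0 < m) {cls : X → Fin m}
    (hcls : ∀ c, (Finset.univ.filter fun x : X => cls x = c).card = n) {α β : ℝ} (hβ : 0 ≤ β)
    (hβα : β < α) (hα : α < 1) (hgraph : IsSimilarityGraph P A cls α β)
    {y : N → Fin m} (hy : Measurable y) (g : X → Fin m) :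
    ∃ σ : Fin m → Fin m, (P ⊗ₘ A).real {p | σ (cls p.2) ≠ y p.1} ≤
      2 * (P ⊗ₘ A).real {p | g p.2 ≠ y p.1} /
        (1 - (1 - α) / ((1 - α) + (α - β) * n + β * (m * n))) +
      (P ⊗ₘ A).real {p | g p.2 ≠ y p.1} := by
  have hn' : (0 : ℝ) < n := by exact_mod_cast hn
  have hm' : (0 : ℝ) < m := by exact_mod_cast hm
  obtain ⟨D, hD⟩ : ∃ D : ℝ, D = (1 - α) + (α - β) * n + β * (m * n) := ⟨_, rfl⟩
  have hgap : 0 < (α - β) * n + β * (m * n) := by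
    have h1 : 0 < (α - β) * n := mul_pos (by linarith) hn'
    have h2 : 0 ≤ β * (m * n) := by positivity
    linarith
  have hD0 : 0 < D := by linarith
  obtain ⟨T, hT⟩ : ∃ T : ℝ, T = m * n := ⟨_, rfl⟩
  have hT0 : 0 < T := hT ▸ mul_pos hm' hn'
  have hsum : ∑ u, ∑ v, similarity cls α β u v = T * D := by
    rw [sum_sum_similarity hcls, hT, hD]
  have hw : ∀ x, augMarginal P A x = 1 / T := fun x => by
    rw [hgraph.augMarginal_eq hcls (hD ▸ hD0.ne'), hT]
  obtain ⟨σ, hσ⟩ := exists_sum_ne_le_sum_similarity hcls hβ hβα.le g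
  refine ⟨σ, ?_⟩
  rw [← hD]
  set ε := (P ⊗ₘ A).real {p | g p.2 ≠ y p.1} with hε
  have hedge := sum_augWeight_ne_le P A hy g
  have hdis : (P ⊗ₘ A).real {p | σ (cls p.2) ≠ g p.2} ≤ 2 * ε / (1 - (1 - α) / D) := by
    rw [real_compProd_ne_eq P A g fun x => σ (cls x)]
    simp only [hw, ← Finset.mul_sum]
    have h1 : ∑ x, ∑ x', augWeight P A x x' * (if g x ≠ g x' then 1 else 0) =
        (∑ x, ∑ x', similarity cls α β x x' * (if g x ≠ g x' then 1 else 0)) / (T * D) := by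
      simp only [Finset.sum_div]
      exact Finset.sum_congr rfl fun x _ => Finset.sum_congr rfl fun x' _ => by
        rw [hgraph x x', hsum]; ring
    rw [h1, div_le_iff₀ (by positivity)] at hedge
    -- The gap is exactly the constant of the majority-vote inequality over `D`.
    have h2 : 1 - (1 - α) / D = n * ((α - β) + m * β) / D := by
      field_simp
      rw [hD]
      ring
    have h3 : 0 < n * ((α - β) + m * β) := by
      have : n * ((α - β) + m * β) = (α - β) * n + β * (m * n) := by ring
      rw [this]
      exact hgap
    rw [h2, le_div_iff₀ (div_pos h3 hD0), one_div, ← div_eq_inv_mul, div_mul_div_comm,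
      div_le_iff₀ (by positivity)]
    linarith
  have hsub : {p : N × X | σ (cls p.2) ≠ y p.1} ⊆
      {p | σ (cls p.2) ≠ g p.2} ∪ {p | g p.2 ≠ y p.1} := by
    intro p hp
    by_cases h : σ (cls p.2) = g p.2
    · exact Or.inr fun h' => hp (h.trans h')
    · exact Or.inl h
  exact (measureReal_mono hsub).trans ((measureReal_union_le _ _).trans (by linarith))

/-- If the features linearly represent every class-constant function, then the linear probing
error is at most the error of any labelling of the classes. -/
theorem linearProbingError_le_of_exists {N X : Type*} [MeasurableSpace N] [MeasurableSpace X]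
    {P : Measure N} {A : Kernel N X} {m m' k : ℕ} {cls : X → Fin m'} {f : X → Fin k → ℝ}
    (hf : ∀ t : Fin m' → ℝ, ∃ b, ∀ x, f x ⬝ᵥ b = t (cls x)) (y : N → Fin m)
    {s : (Fin m → ℝ) → Fin m} (hs : IsArgmaxRule s) (σ : Fin m' → Fin m) :
    linearProbingError P A y s f ≤ (P ⊗ₘ A).real {p | σ (cls p.2) ≠ y p.1} := by
  -- Row `i` of the head represents the indicator of `σ = i`, so the output is one-hot at `σ (cls
  -- x)` and no tie can occur.
  choose B hB using fun i : Fin m => hf fun c => if i = σ c then 1 else 0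
  have hpred : ∀ x, s ((of B).mulVec (f x)) = σ (cls x) := by
    intro x
    have hv : ∀ i, (of B).mulVec (f x) i = if i = σ (cls x) then 1 else 0 := fun i => by
      rw [← hB, dotProduct_comm]; rfl
    have h := hs ((of B).mulVec (f x)) (σ (cls x))
    rw [hv, hv] at h
    by_contra hne
    rw [if_pos rfl, if_neg hne] at h
    linarith
  refine (ciInf_le ⟨0, ?_⟩ (of B)).trans (le_of_eq ?_)
  · rintro _ ⟨B', rfl⟩
    exact measureReal_nonneg
  · simp only [hpred]

end ContrastiveLearning

theorem theorem1 {N X : Type*} [MeasurableSpace N]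
    [Fintype X] [DecidableEq X] [MeasurableSpace X] [MeasurableSingletonClass X]
    (P : Measure N) [IsProbabilityMeasure P] (A : Kernel N X) [IsMarkovKernel A]
    (n r k : ℕ) (hk : r < k)
    (y : N → Fin (r + 1)) (hy : Measurable y)
    (cls : X → Fin (r + 1))
    (hcls : ∀ c : Fin (r + 1), (Finset.univ.filter fun x : X => cls x = c).card = n)
    (α β δ : ℝ) (hβ : 0 ≤ β) (hβα : β < α) (hα : α < 1)
    (hgraph : ContrastiveLearning.IsSimilarityGraph P A cls α β)
    (hrec : ContrastiveLearning.LabelsRecoverable P A y δ)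
    (H : Set (X → Fin k → ℝ)) (hreal : ContrastiveLearning.Realizable P A H)
    (f : X → Fin k → ℝ) (hf : ContrastiveLearning.IsSpectralMinimizer P A H f)
    (s : (Fin (r + 1) → ℝ) → Fin (r + 1)) (hs : ContrastiveLearning.IsArgmaxRule s) :
    ContrastiveLearning.linearProbingError P A y s f ≤
      4 * δ / (1 - (1 - α) / ((1 - α) + (n : ℝ) * α + (n : ℝ) * (r : ℝ) * β)) + 8 * δ := by
  open ContrastiveLearning in
  obtain ⟨z⟩ : Nonempty N := nonempty_of_isProbabilityMeasure P
  obtain ⟨x₀⟩ : Nonempty X := nonempty_of_isProbabilityMeasure (A z)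
  have hn : 0 < n := by
    rw [← hcls (cls x₀)]
    exact Finset.card_pos.2 ⟨x₀, by simp⟩
  obtain ⟨f₀, hf₀, hmin⟩ := hreal
  -- Realizability promotes a minimizer over `H` to a global one.
  have hfmin : ∀ f', spectralLoss P A f ≤ spectralLoss P A f' := fun f' =>
    (hf.2 f₀ hf₀).trans (hmin f')
  obtain ⟨g, hg⟩ := hrec
  set ε := (P ⊗ₘ A).real {p | g p.2 ≠ y p.1} with hε
  have hε0 : 0 ≤ ε := measureReal_nonneg
  have hεδ : ε ≤ δ := by
    have h := probReal_compl_eq_one_sub (μ := P ⊗ₘ A) (measurableSet_label_ne hy g)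
    have hc : {p : N × X | g p.2 ≠ y p.1}ᶜ = {p | g p.2 = y p.1} := by
      ext p
      simp
    rw [hc] at h
    linarith
  obtain ⟨σ, hσ⟩ := exists_real_compProd_class_label_ne_le P A hn r.succ_pos hcls hβ hβα hα
    hgraph hy g
  have hprobe := linearProbingError_le_of_exists (P := P) (A := A)
    (exists_dotProduct_eq_of_minimizer hk hn r.succ_pos hcls hβ hβα hα hgraph hfmin) y hs σ
  have hD : (1 - α) + (α - β) * n + β * (((r + 1 : ℕ) : ℝ) * n) =
      (1 - α) + (n : ℝ) * α + (n : ℝ) * (r : ℝ) * β := by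
    push_cast
    ring
  rw [hD, ← hε] at hσ
  set D : ℝ := (1 - α) + (n : ℝ) * α + (n : ℝ) * (r : ℝ) * β with hDdef
  have hgap : 0 ≤ 1 - (1 - α) / D := by
    have hα0 : 0 < α := hβ.trans_lt hβα
    have h1 : 0 ≤ (n : ℝ) * α + (n : ℝ) * (r : ℝ) * β := by positivity
    rw [sub_nonneg]
    exact div_le_one_of_le₀ (by linarith) (by linarith)
  -- The argument gives `2 ε / gap + ε`; `0 ≤ ε ≤ δ` leaves room up to `4 δ / gap + 8 δ`.
  have hquot : 2 * ε / (1 - (1 - α) / D) ≤ 4 * δ / (1 - (1 - α) / D) :=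
    div_le_div_of_nonneg_right (by linarith) hgap
  linarith
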